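/- Let $P,Q$ be partially ordered sets. A subset $C\subseteq Q$ is cofinal if for every $q\in Q$ there is $c\in C$ with $q\le c$. Write $P\preceq Q$ if there is a monotone map $\psi\colon P\to Q$ whose image is cofinal in $Q$, and $P\approx Q$ if $P\preceq Q$ and $Q\preceq P$. For a topological space $X$, let $\mathrm K(X)$ be the family of compact subsets of $X$, ordered by inclusion. Let $\mathrm d(X)$ be the minimal cardinality of a dense subset of $X$. For $x\in X$, let $\mathrm{ld}(x)$ be the minimal density $\mathrm d(U)$ of a neighborhood $U$ of $x$ (with the subspace topology), and let $\mathrm{ld}(X)=\sup_{x\in X}\mathrm{ld}(x)$. The local density of $X$ is realized if $\mathrm{ld}(x)=\mathrm{ld}(X)$ for some $x\in X$. For a set $S$, let $\mathrm{fin}(S)$ be the family of finite subsets of $S$, ordered by inclusion, and let $\mathrm{fin}(S)^{\mathbb N}$ be the set of functions $f\colon\mathbb N\to\mathrm{fin}(S)$, ordered by $f\le g$ if $f(n)\subseteq g(n)$ for all $n$. A cardinal $\kappa$ is identified with the set of ordinals smaller than $\kappa$. For an infinite cardinal $\kappa$, let $\mathrm{Bdd}(\mathrm{fin}(\kappa)^{\mathbb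 N})=\bigcup_{\alpha<\kappa}\mathrm{fin}(\alpha)^{\mathbb N}\subseteq\mathrm{fin}(\kappa)^{\mathbb N}$, where $\alpha$ ranges over the ordinals below $\kappa$, with the induced order. Products of partially ordered sets carry the coordinatewise order. **Theorem.** Let $X$ be a complete metric space. 1. If $X$ is noncompact and locally compact, then $\mathrm K(X)\approx\mathrm{fin}(\mathrm d(X))$. 2. If $X$ is not locally compact, then: - (a) if the local density of $X$ is not realized, then $\mathrm K(X)\approx\mathrm{fin}(\mathrm d(X))\times\mathrm{Bdd}(\mathrm{fin}(\mathrm{ld}(X))^{\mathbb N})$; - (b) if the local density of $X$ is realized, or the cardinal $\mathrm{ld}(X)$ has uncountable cofinality, then $\mathrm K(X)\approx\mathrm{fin}(\mathrm d(X))\times\mathrm{fin}(\mathrm{ld}(X))^{\mathbb N}$. -/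

import Mathlib

universe u v w

/-- `P ⪯ Q`: there is a monotone map `P → Q` whose image is cofinal in `Q`. -/
def CofinalLE (P : Type v) (Q : Type w) [Preorder P] [Preorder Q] : Prop :=
  ∃ ψ : P → Q, Monotone ψ ∧ IsCofinal (Set.range ψ)

/-- Cofinal equivalence `P ≈ Q`: both `P ⪯ Q` and `Q ⪯ P`. -/
def CofinalEquiv (P : Type v) (Q : Type w) [Preorder P] [Preorder Q] : Prop :=
  CofinalLE P Q ∧ CofinalLE Q P

/-- The density of a topological space: the minimal cardinality of a dense subset. -/
noncomputable def topDensity (X : Type u) [TopologicalSpace X] : Cardinal.{u} :=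
  sInf {c | ∃ D : Set X, Dense D ∧ Cardinal.mk D = c}

/-- The local density of a point: the minimal density of a neighborhood of the point
(each neighborhood with its subspace topology). -/
noncomputable def localDensityAt {X : Type u} [TopologicalSpace X] (x : X) : Cardinal.{u} :=
  sInf {c | ∃ U : Set X, U ∈ nhds x ∧ topDensity U = c}

/-- The local density of a space: the supremum of the local densities of its points. -/
noncomputable def localDensity (X : Type u) [TopologicalSpace X] : Cardinal.{u} :=
  ⨆ x : X, localDensityAt x

/-- The local density of the space is realized by some point. -/
def LocalDensityRealized (X : Type u) [TopologicalSpace X] : Prop :=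
  ∃ x : X, localDensityAt x = localDensity X

/-- `fin(κ)`: the finite subsets of `κ`, ordered by inclusion. As usual in set theory, the
cardinal `κ` is the set of all ordinals smaller than (the initial ordinal of) `κ`. -/
abbrev FinSubsets (κ : Cardinal.{u}) : Type (u + 1) :=
  Finset (Set.Iio κ.ord)

/-- `fin(κ)^ℕ`, ordered by pointwise inclusion. -/
abbrev FinSeq (κ : Cardinal.{u}) : Type (u + 1) :=
  ℕ → FinSubsets κ

/-- `Bdd(fin(κ)^ℕ) = ⋃_{α < κ} fin(α)^ℕ`, the union over all ordinals `α < κ`, with the order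
inherited from `fin(κ)^ℕ`. -/
abbrev BddFinSeq (κ : Cardinal.{u}) : Type (u + 1) :=
  {f : FinSeq κ // ∃ α : Ordinal.{u}, α < κ.ord ∧ ∀ n, ∀ β ∈ f n, (β : Ordinal.{u}) < α}

open Set Filter Topology TopologicalSpace

/-! Lower bounds. If `X` is not compact, choose a sequence `y` with finitely many indices in each
compact set, and maximal `1/(m+1)`-separated sets `D m`. The union of the `D m` is dense, and a
compact set contains only finitely many pairs `{y m, d}` with `d ∈ D m`; this gives `fin(d(X))`
(`cofinalLE_compacts_finset`). Applied in balls shrinking to a point without compact neighborhoods,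
it gives `fin(S)^ℕ`, because compact subsets of these balls glue together once the center is added.
Upper bounds. `X` is covered by the interiors of `d(X)` closed sets, each in the closure of a family
indexed by ordinals below `ld(X)`. A compact set lies in finitely many of them, and finite nets at
all scales `1/(n+1)` describe its traces; one `f : ℕ → fin` serves finitely many pieces at once.
Completeness turns such data back into compact sets (`finSubsets_prod_cofinalLE_compacts`). If the
local density is not realized, each piece needs only a bounded set of indices, whence `Bdd`. Under
uncountable cofinality every sequence is bounded. Since `K(X)` is directed, separate lower bounds
combine into a product. -/

/-- A directed poset that dominates two posets dominates their product. -/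
theorem CofinalLE.prod {P Q R : Type*} [Preorder P] [IsDirectedOrder P] [Preorder Q] [Preorder R]
    (hQ : CofinalLE P Q) (hR : CofinalLE P R) : CofinalLE P (Q × R) := by
  obtain ⟨f, hf, hf'⟩ := hQ
  obtain ⟨g, hg, hg'⟩ := hR
  refine ⟨fun p => (f p, g p), fun a b h => ⟨hf h, hg h⟩, fun ⟨q, r⟩ => ?_⟩
  obtain ⟨_, ⟨a, rfl⟩, ha⟩ := hf' q
  obtain ⟨_, ⟨b, rfl⟩, hb⟩ := hg' r
  obtain ⟨c, hac, hbc⟩ := exists_ge_ge a b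
  exact ⟨_, ⟨c, rfl⟩, ha.trans (hf hac), hb.trans (hg hbc)⟩

/-! ### Density and local density. -/

theorem exists_dense_mk_eq_topDensity (X : Type u) [TopologicalSpace X] :
    ∃ D : Set X, Dense D ∧ Cardinal.mk D = topDensity X :=
  csInf_mem (s := {c | ∃ D : Set X, Dense D ∧ Cardinal.mk D = c}) ⟨_, univ, dense_univ, rfl⟩

theorem topDensity_le {X : Type u} [TopologicalSpace X] {D : Set X} (hD : Dense D) :
    topDensity X ≤ Cardinal.mk D :=
  csInf_le' ⟨D, hD, rfl⟩

theorem exists_nhds_topDensity_eq {X : Type u} [TopologicalSpace X] (x : X) :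
    ∃ U ∈ 𝓝 x, topDensity U = localDensityAt x :=
  csInf_mem (s := {c | ∃ U : Set X, U ∈ 𝓝 x ∧ topDensity U = c}) ⟨_, univ, univ_mem, rfl⟩

theorem localDensityAt_le_of_mem_nhds {X : Type u} [TopologicalSpace X] {x : X} {U : Set X}
    (hU : U ∈ 𝓝 x) : localDensityAt x ≤ topDensity U :=
  csInf_le' ⟨U, hU, rfl⟩

theorem localDensityAt_le {X : Type u} [TopologicalSpace X] (x : X) :
    localDensityAt x ≤ localDensity X :=
  le_ciSup (f := fun x : X => localDensityAt x) (Cardinal.bddAbove_of_small) x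

theorem localDensityAt_le_topDensity {X : Type u} [TopologicalSpace X] (x : X) :
    localDensityAt x ≤ topDensity X := by
  obtain ⟨D, hD, hc⟩ := exists_dense_mk_eq_topDensity X
  have hd : Dense ((↑) ⁻¹' D : Set (univ : Set X)) :=
    hD.preimage (Homeomorph.Set.univ X).isOpenMap
  refine (localDensityAt_le_of_mem_nhds univ_mem).trans ((topDensity_le hd).trans ?_)
  rw [← hc]
  exact Cardinal.mk_preimage_of_injective _ _ Subtype.val_injective

theorem localDensity_le_topDensity (X : Type u) [TopologicalSpace X] :
    localDensity X ≤ topDensity X :=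
  ciSup_le' localDensityAt_le_topDensity

theorem aleph0_le_topDensity {X : Type u} [TopologicalSpace X] [T1Space X]
    (hX : ¬ CompactSpace X) : Cardinal.aleph0 ≤ topDensity X := by
  obtain ⟨D, hD, hc⟩ := exists_dense_mk_eq_topDensity X
  by_contra! h
  rw [← hc, Cardinal.lt_aleph0_iff_set_finite] at h
  have : D = univ := by rw [← h.isClosed.closure_eq, hD.closure_eq]
  subst this
  exact hX ⟨h.isCompact⟩

theorem aleph0_le_localDensityAt {X : Type u} [TopologicalSpace X] [T1Space X] {x : X}
    (hx : ∀ U ∈ 𝓝 x, ¬ IsCompact U) : Cardinal.aleph0 ≤ localDensityAt x := by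
  obtain ⟨U, hU, h⟩ := exists_nhds_topDensity_eq x
  rw [← h]
  exact aleph0_le_topDensity fun hc => hx U hU (isCompact_iff_compactSpace.2 hc)

theorem not_isCompact_of_aleph0_lt_localDensityAt {X : Type u} [MetricSpace X] {x : X}
    (hx : Cardinal.aleph0 < localDensityAt x) : ∀ U ∈ 𝓝 x, ¬ IsCompact U := by
  intro U hU hc
  have := isCompact_iff_compactSpace.1 hc
  obtain ⟨D, hD, hd⟩ := exists_countable_dense U
  refine (hx.trans_le ((localDensityAt_le_of_mem_nhds hU).trans (topDensity_le hd))).not_ge ?_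
  exact Cardinal.le_aleph0_iff_set_countable.2 hD

theorem exists_forall_mem_nhds_not_isCompact {X : Type u} [TopologicalSpace X] [T2Space X]
    (hX : ¬ LocallyCompactSpace X) : ∃ x : X, ∀ U ∈ 𝓝 x, ¬ IsCompact U := by
  by_contra! h
  have : WeaklyLocallyCompactSpace X := ⟨fun x => by
    obtain ⟨U, hU, hc⟩ := h x
    exact ⟨U, hc, hU⟩⟩
  exact hX inferInstance

/-! ### Lower bounds: compact sets dominate finite sets and sequences of them. -/

theorem exists_seq_finite_mem_isCompact {X : Type u} [MetricSpace X] (hX : ¬ CompactSpace X) :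
    ∃ y : ℕ → X, ∀ K : Set X, IsCompact K → {n | y n ∈ K}.Finite := by
  by_contra! h
  refine hX (compactSpace_iff_seqCompactSpace.2 ⟨fun y _ => ?_⟩)
  obtain ⟨K, hK, hy⟩ := h y
  obtain ⟨a, -, φ, hφ, ht⟩ := hK.tendsto_subseq' (Nat.frequently_atTop_iff_infinite.2 hy)
  exact ⟨a, mem_univ _, φ, hφ, ht⟩

/-- A compact set has a finite cover at scale `ε / 2`, and each of its pieces holds at most one
point of an `ε`-separated set. -/
theorem Metric.IsSeparated.finite_of_isCompact {X : Type u} [MetricSpace X] {ε : NNReal}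
    (hε : 0 < ε) {D K : Set X} (hD : Metric.IsSeparated (ε : ENNReal) D) (hK : IsCompact K) :
    (D ∩ K).Finite := by
  obtain ⟨N, -, hN, hc⟩ := Metric.exists_finite_isCover_of_totallyBounded (ε := ε / 2)
    (by positivity) hK.totallyBounded
  have h1 : (D ∩ K).encard ≤ Metric.packingNumber ε K :=
    Metric.IsSeparated.encard_le_packingNumber inter_subset_right (hD.subset inter_subset_left)
  have h2 := Metric.packingNumber_two_mul_le_externalCoveringNumber (ε / 2) K
  rw [mul_div_cancel₀ _ two_ne_zero] at h2
  have h3 := hc.externalCoveringNumber_le_encard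
  exact finite_of_encard_le_coe (k := N.ncard) (by
    rw [hN.cast_ncard_eq]; exact h1.trans (h2.trans h3))

theorem Metric.exists_isSeparated_isCover {X : Type u} [MetricSpace X] (ε : NNReal) :
    ∃ D : Set X, Metric.IsSeparated (ε : ENNReal) D ∧ ∀ x, ∃ d ∈ D, edist x d ≤ ε := by
  obtain ⟨D, hD⟩ := zorn_subset {N : Set X | N ⊆ univ ∧ Metric.IsSeparated (ε : ENNReal) N}
    fun c hc hchain => ⟨⋃₀ c, ⟨subset_univ _, (pairwise_sUnion hchain.directedOn).2
      fun s hs => (hc hs).2⟩, fun s hs => subset_sUnion_of_mem hs⟩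
  refine ⟨D, hD.prop.2, fun x => ?_⟩
  exact Metric.IsCover.of_maximal_isSeparated (s := univ) hD (mem_univ x)

/-- In a noncompact metric space, any set `S` with at most `topDensity X` elements indexes
a family of two-point compact sets such that only finitely many of them lie in a given compact
set. -/
theorem cofinalLE_compacts_finset {X : Type u} [MetricSpace X] (hX : ¬ CompactSpace X)
    (S : Type v) (hS : Cardinal.lift.{u} (Cardinal.mk S) ≤ Cardinal.lift.{v} (topDensity X)) :
    CofinalLE (Compacts X) (Finset S) := by
  obtain ⟨y, hy⟩ := exists_seq_finite_mem_isCompact hX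
  choose D hD hD' using fun m : ℕ =>
    Metric.exists_isSeparated_isCover (X := X) (1 / ((m : NNReal) + 1))
  have hdense : Dense (range fun s : Σ m, D m => (s.2 : X)) := by
    refine fun x => Metric.mem_closure_iff.2 fun ε hε => ?_
    obtain ⟨m, hm⟩ := exists_nat_one_div_lt hε
    obtain ⟨d, hd, h⟩ := hD' m x
    refine ⟨d, ⟨⟨m, d, hd⟩, rfl⟩, lt_of_le_of_lt ?_ hm⟩
    rw [edist_nndist, ENNReal.coe_le_coe] at h
    exact_mod_cast h
  have hcard : topDensity X ≤ Cardinal.mk (Σ m, D m) :=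
    (topDensity_le hdense).trans Cardinal.mk_range_le
  obtain ⟨ι⟩ := Cardinal.lift_mk_le'.1 (hS.trans (Cardinal.lift_le.2 hcard))
  -- The point `y m` bounds the level `m`: without it, a compact set could meet infinitely many of
  -- the sets `D m`.
  have hfin : ∀ K : Compacts X, {s : S | y (ι s).1 ∈ K ∧ ((ι s).2 : X) ∈ K}.Finite := by
    intro K
    have hDK : ∀ m, {d : D m | (d : X) ∈ K}.Finite := fun m =>
      (((hD m).finite_of_isCompact (by positivity) K.isCompact).preimage
        (f := ((↑) : D m → X)) Subtype.val_injective.injOn).subset fun d hd => ⟨d.2, hd⟩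
    refine (Finite.preimage ι.injective.injOn ((hy K K.isCompact).toFinset.sigma
      fun m => (hDK m).toFinset).finite_toSet).subset fun s hs => ?_
    simpa using hs
  refine ⟨fun K => (hfin K).toFinset, fun K L h => ?_, fun F => ?_⟩
  · exact Finite.toFinset_subset_toFinset.2 fun s hs => ⟨h hs.1, h hs.2⟩
  · refine ⟨_, ⟨⟨⋃ s ∈ F, {y (ι s).1, ((ι s).2 : X)},
      F.isCompact_biUnion fun s _ => (toFinite _).isCompact⟩, rfl⟩, fun s hs => ?_⟩
    simp only [Finite.mem_toFinset, mem_ofPred_eq]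
    exact ⟨mem_biUnion hs (by simp), mem_biUnion hs (by simp)⟩

/-- An ultrafilter on the union either contains some `K n`, and converges there, or avoids each of
them; then it lives on the tails, which shrink to `x`. -/
theorem isCompact_insert_iUnion {X : Type u} [MetricSpace X] (x : X) (K : ℕ → Set X)
    (hK : ∀ n, IsCompact (K n)) (hx : ∀ n, K n ⊆ Metric.closedBall x (1 / (n + 1))) :
    IsCompact (insert x (⋃ n, K n)) := by
  refine isCompact_iff_ultrafilter_le_nhds.2 fun f hf => ?_
  by_cases h : ∃ n, K n ∈ f
  · obtain ⟨n, hn⟩ := h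
    obtain ⟨a, ha, hfa⟩ := isCompact_iff_ultrafilter_le_nhds.1 (hK n) f (le_principal_iff.2 hn)
    exact ⟨a, mem_insert_of_mem _ (mem_iUnion_of_mem n ha), hfa⟩
  push Not at h
  refine ⟨x, mem_insert _ _, Metric.nhds_basis_ball.ge_iff.2 fun ε hε => ?_⟩
  obtain ⟨N, hN⟩ := exists_nat_one_div_lt hε
  have hfin : (⋂ n ∈ Iio N, (K n)ᶜ) ∈ (f : Filter X) :=
    (biInter_mem (finite_Iio N)).2 fun n _ => Ultrafilter.compl_mem_iff_notMem.2 (h n)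
  filter_upwards [hfin, le_principal_iff.1 hf] with z hz hz'
  rcases hz' with rfl | hz'
  · exact Metric.mem_ball_self hε
  obtain ⟨n, hn⟩ := mem_iUnion.1 hz'
  have hNn : N ≤ n := by
    by_contra! hlt
    exact mem_iInter₂.1 hz n hlt hn
  refine lt_of_le_of_lt (hx n hn) (lt_of_le_of_lt ?_ hN)
  gcongr

/-- If no neighborhood of `x` is compact, the compact sets near `x` dominate `fin(S)^ℕ` for every
set `S` of size at most the local density of `x`. -/
theorem cofinalLE_compacts_seq_finset {X : Type u} [MetricSpace X] {x : X}
    (hx : ∀ U ∈ 𝓝 x, ¬ IsCompact U) (S : Type v)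
    (hS : Cardinal.lift.{u} (Cardinal.mk S) ≤ Cardinal.lift.{v} (localDensityAt x)) :
    CofinalLE (Compacts X) (ℕ → Finset S) := by
  have hB : ∀ n : ℕ, Metric.closedBall x (1 / ((n : ℝ) + 1)) ∈ 𝓝 x := fun n =>
    Metric.closedBall_mem_nhds x (by positivity)
  choose ψ hψ hψ' using fun n : ℕ => cofinalLE_compacts_finset
    (X := Metric.closedBall x (1 / ((n : ℝ) + 1)))
    (fun h => hx _ (hB n) (isCompact_iff_compactSpace.2 h)) S
    (hS.trans (Cardinal.lift_le.2 (localDensityAt_le_of_mem_nhds (hB n))))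
  refine ⟨fun K n => ψ n ⟨(↑) ⁻¹' (K : Set X), (Metric.isClosed_closedBall
    |>.isClosedEmbedding_subtypeVal).isCompact_preimage K.isCompact⟩,
    fun K L h n => hψ n fun z hz => h hz, fun f => ?_⟩
  have hex : ∀ n, ∃ K, f n ≤ ψ n K := fun n => by
    obtain ⟨_, ⟨K, rfl⟩, h⟩ := hψ' n (f n)
    exact ⟨K, h⟩
  choose K hK using hex
  refine ⟨_, ⟨⟨insert x (⋃ n : ℕ, Subtype.val '' (K n : Set (Metric.closedBall x (1 / ((n : ℝ) + 1))))),
    isCompact_insert_iUnion x _ (fun n => (K n).isCompact.image continuous_subtype_val)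
      fun n => ?_⟩, rfl⟩, fun n => (hK n).trans (hψ n fun z hz => ?_)⟩
  · rintro _ ⟨z, -, rfl⟩
    exact z.2
  · exact mem_insert_of_mem _ (mem_iUnion_of_mem n ⟨z, hz, rfl⟩)

theorem Cardinal.mk_Iio_ord (c : Cardinal.{u}) :
    Cardinal.mk (Iio c.ord) = Cardinal.lift.{u + 1} c := by
  rw [Cardinal.mk_Iio_ordinal, Cardinal.card_ord]

theorem Cardinal.nonempty_Iio_ord_equiv {α : Type u} {c : Cardinal.{u}}
    (h : Cardinal.mk α = c) : Nonempty (Iio c.ord ≃ α) :=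
  Cardinal.lift_mk_eq'.1 (by rw [Cardinal.mk_Iio_ord, h, Cardinal.lift_lift])

theorem cofinalLE_compacts_finSubsets {X : Type u} [MetricSpace X] (hX : ¬ CompactSpace X)
    {c : Cardinal.{u}} (hc : c ≤ topDensity X) : CofinalLE (Compacts X) (FinSubsets c) :=
  cofinalLE_compacts_finset hX _ (by
    rw [Cardinal.mk_Iio_ord, Cardinal.lift_lift, Cardinal.lift_le]; exact hc)

/-! ### Upper bounds: closed covers and finite approximations. -/

/-- A space which locally has a hereditary property is covered by the interiors of `topDensity X`
many closed sets with this property. -/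
theorem exists_closed_cover {X : Type u} [MetricSpace X] (hX : ¬ CompactSpace X)
    {P : Set X → Prop} (hP : ∀ U V, U ⊆ V → P V → P U) (h : ∀ x, ∃ U ∈ 𝓝 x, P U) :
    ∃ C : Iio (topDensity X).ord → Set X,
      (∀ i, IsClosed (C i)) ∧ (∀ i, P (C i)) ∧ ∀ x, ∃ i, C i ∈ 𝓝 x := by
  classical
  have hne : Nonempty X := by
    by_contra! hemp
    exact hX inferInstance
  obtain ⟨x₀⟩ := hne
  have hP₀ : P ∅ := by
    obtain ⟨U, -, hU⟩ := h x₀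
    exact hP _ _ (empty_subset _) hU
  obtain ⟨D, hD, hcard⟩ := exists_dense_mk_eq_topDensity X
  have hinf := aleph0_le_topDensity hX
  obtain ⟨e⟩ := Cardinal.nonempty_Iio_ord_equiv (α := D × ℕ) (c := topDensity X) (by
    simp [hcard, Cardinal.mul_eq_left hinf hinf Cardinal.aleph0_ne_zero])
  let B : D × ℕ → Set X := fun p => Metric.closedBall (p.1 : X) (1 / ((p.2 : ℝ) + 1))
  -- Balls without the property are replaced by the empty set, which has it by heredity.
  refine ⟨fun i => if P (B (e i)) then B (e i) else ∅, fun i => ?_, fun i => ?_, fun x => ?_⟩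
  · dsimp only
    split_ifs
    exacts [Metric.isClosed_closedBall, isClosed_empty]
  · dsimp only
    split_ifs with h
    exacts [h, hP₀]
  · obtain ⟨U, hU, hPU⟩ := h x
    obtain ⟨ε, hε, hball⟩ := Metric.mem_nhds_iff.1 hU
    -- The ball is centered at `d` rather than `x`, so its points may be two radii away from `x`.
    obtain ⟨n, hn⟩ := exists_nat_one_div_lt (half_pos hε)
    have hpos : (0 : ℝ) < 1 / ((n : ℝ) + 1) := by positivity
    obtain ⟨d, hd, hxd⟩ := hD.exists_dist_lt x hpos
    have hsub : B (⟨d, hd⟩, n) ⊆ U := fun z hz => hball (by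
      have hz' : dist z d ≤ 1 / ((n : ℝ) + 1) := hz
      rw [Metric.mem_ball]
      linarith [dist_triangle_right z x d])
    refine ⟨e.symm (⟨d, hd⟩, n), ?_⟩
    simp only [Equiv.apply_symm_apply, if_pos (hP _ _ hsub hPU)]
    exact mem_of_superset (Metric.isOpen_ball.mem_nhds hxd) Metric.ball_subset_closedBall

theorem exists_finset_subset_iUnion {X : Type u} [TopologicalSpace X] {I : Type v}
    {C : I → Set X} (hC : ∀ x, ∃ i, C i ∈ 𝓝 x) (K : Compacts X) :
    ∃ F : Finset I, (K : Set X) ⊆ ⋃ i ∈ F, C i := by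
  classical
  choose i hi using hC
  obtain ⟨t, -, ht⟩ := K.isCompact.elim_nhds_subcover (fun x => C (i x)) fun x _ => hi x
  refine ⟨t.image i, ht.trans fun z hz => ?_⟩
  simpa using hz

theorem finSubsets_cofinalLE_compacts {X : Type u} [MetricSpace X] (hX : ¬ CompactSpace X)
    [LocallyCompactSpace X] : CofinalLE (FinSubsets (topDensity X)) (Compacts X) := by
  obtain ⟨C, hC, hP, hcov⟩ := exists_closed_cover hX
    (P := fun U => ∃ K : Set X, IsCompact K ∧ U ⊆ K)
    (fun U V hUV ⟨K, hK, h⟩ => ⟨K, hK, hUV.trans h⟩)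
    fun x => by
      obtain ⟨K, hK, h⟩ := exists_compact_mem_nhds x
      exact ⟨K, h, K, hK, Subset.rfl⟩
  have hcpt : ∀ i, IsCompact (C i) := fun i => by
    obtain ⟨K, hK, h⟩ := hP i
    exact hK.of_isClosed_subset (hC i) h
  refine ⟨fun F => ⟨⋃ i ∈ F, C i, F.isCompact_biUnion fun i _ => hcpt i⟩,
    fun F G h => biUnion_subset_biUnion_left h, fun K => ?_⟩
  obtain ⟨F, hF⟩ := exists_finset_subset_iUnion hcov K
  exact ⟨_, ⟨F, rfl⟩, hF⟩

/-- The points of `C` which can be approximated, for each `n`, up to `1 / (n + 1)` by some `e j`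
with `j ∈ f n` and `j ∈ A`. -/
def approximable {X : Type u} [MetricSpace X] {J : Type v} (C : Set X) (e : J → X) (A : Set J)
    (f : ℕ → Finset J) : Set X :=
  {x ∈ C | ∀ n : ℕ, ∃ j ∈ f n, j ∈ A ∧ dist x (e j) ≤ 1 / ((n : ℝ) + 1)}

theorem approximable_mono {X : Type u} [MetricSpace X] {J : Type v} (C : Set X) (e : J → X)
    (A : Set J) : Monotone (approximable C e A) := fun _ _ h _ hx =>
  ⟨hx.1, fun n => by
    obtain ⟨j, hj, hjA⟩ := hx.2 n
    exact ⟨j, h n hj, hjA⟩⟩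

/-- At each scale finitely many balls suffice, so the set is totally bounded; it is closed and the
space is complete. -/
theorem isCompact_approximable {X : Type u} [MetricSpace X] [CompleteSpace X] {J : Type v}
    {C : Set X} (hC : IsClosed C) (e : J → X) (A : Set J) (f : ℕ → Finset J) :
    IsCompact (approximable C e A f) := by
  have heq : approximable C e A f =
      C ∩ ⋂ n : ℕ, ⋃ j ∈ {j | j ∈ f n ∧ j ∈ A}, Metric.closedBall (e j) (1 / ((n : ℝ) + 1)) := by
    ext x
    simp [approximable, and_assoc]
  have hfin : ∀ n, {j | j ∈ f n ∧ j ∈ A}.Finite := fun n =>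
    (f n).finite_toSet.subset fun j hj => hj.1
  have hclosed : IsClosed (approximable C e A f) := by
    rw [heq]
    exact hC.inter (isClosed_iInter fun n => (hfin n).isClosed_biUnion fun j _ =>
      Metric.isClosed_closedBall)
  refine TotallyBounded.isCompact_of_isClosed (Metric.totallyBounded_iff.2 fun ε hε => ?_) hclosed
  obtain ⟨n, hn⟩ := exists_nat_one_div_lt hε
  refine ⟨e '' (f n), (f n).finite_toSet.image e, fun x hx => ?_⟩
  obtain ⟨j, hj, -, hd⟩ := hx.2 n
  exact mem_biUnion (mem_image_of_mem e hj) (lt_of_le_of_lt hd hn)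

theorem exists_subset_approximable {X : Type u} [MetricSpace X] {J : Type v} {C K : Set X}
    (hK : IsCompact K) (hKC : K ⊆ C) (e : J → X) {A : Set J} (hA : C ⊆ closure (e '' A)) :
    ∃ f : ℕ → Finset J, (∀ n, ∀ j ∈ f n, j ∈ A) ∧ K ⊆ approximable C e A f := by
  have hex : ∀ n : ℕ, ∃ t : Finset J, ↑t ⊆ A ∧
      K ⊆ ⋃ j ∈ t, Metric.ball (e j) (1 / ((n : ℝ) + 1)) := fun n => by
    obtain ⟨b, hb, hfin, hsub⟩ := hK.elim_finite_subcover_image (b := A)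
      (c := fun j => Metric.ball (e j) (1 / ((n : ℝ) + 1))) (fun _ _ => Metric.isOpen_ball)
      fun x hx => by
        obtain ⟨_, ⟨j, hj, rfl⟩, hd⟩ := Metric.mem_closure_iff.1 (hA (hKC hx))
          (1 / ((n : ℝ) + 1)) (by positivity)
        exact mem_biUnion hj hd
    exact ⟨hfin.toFinset, by simpa using hb, by simpa using hsub⟩
  choose f hf hf' using hex
  refine ⟨f, fun n j hj => hf n hj, fun x hx => ⟨hKC hx, fun n => ?_⟩⟩
  obtain ⟨j, hj, hd⟩ := mem_iUnion₂.1 (hf' n hx)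
  exact ⟨j, hj, hf n hj, le_of_lt hd⟩

/-- A set of functions into `fin(κ)` that contains an upper bound for every finite family of
functions whose values are bounded by ordinals satisfying `Q` gives rise to a cofinal family of
compact sets, provided that each point has a neighborhood contained in the closure of a sequence
whose length satisfies `Q`. -/
theorem finSubsets_prod_cofinalLE_compacts {X : Type u} [MetricSpace X] [CompleteSpace X]
    (hX : ¬ CompactSpace X) {c : Cardinal.{u}} {L : Type w} [Preorder L] (ι : L → FinSeq c)
    (hι : Monotone ι) (Q : Ordinal.{u} → Prop)
    (hQ : ∀ x : X, ∃ U ∈ 𝓝 x, ∃ α, Q α ∧ ∃ e : Ordinal.{u} → X,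
      U ⊆ closure (e '' (Iio α ∩ Iio c.ord)))
    (hL : ∀ (F : FinSubsets (topDensity X)) (α : Iio (topDensity X).ord → Ordinal.{u})
      (f : Iio (topDensity X).ord → FinSeq c), (∀ i, Q (α i)) →
      (∀ i, ∀ n, ∀ β ∈ f i n, (β : Ordinal.{u}) < α i) → ∃ l, ∀ i ∈ F, f i ≤ ι l) :
    CofinalLE (FinSubsets (topDensity X) × L) (Compacts X) := by
  obtain ⟨C, hC, hP, hcov⟩ := exists_closed_cover hX
    (P := fun U => ∃ α, Q α ∧ ∃ e : Ordinal.{u} → X, U ⊆ closure (e '' (Iio α ∩ Iio c.ord)))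
    (fun U V hUV ⟨α, hα, e, h⟩ => ⟨α, hα, e, hUV.trans h⟩) hQ
  choose α hα e he using hP
  let A : Iio (topDensity X).ord → Set (Iio c.ord) := fun i => {β | (β : Ordinal.{u}) < α i}
  let e' : Iio (topDensity X).ord → Iio c.ord → X := fun i β => e i β
  have he' : ∀ i, C i ⊆ closure (e' i '' A i) := fun i => (he i).trans (closure_mono (by
    rintro _ ⟨β, hβ, rfl⟩
    exact ⟨⟨β, hβ.2⟩, hβ.1, rfl⟩))
  refine ⟨fun p => ⟨⋃ i ∈ p.1, approximable (C i) (e' i) (A i) (ι p.2),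
    p.1.isCompact_biUnion fun i _ => isCompact_approximable (hC i) _ _ _⟩, fun p q h => ?_,
    fun K => ?_⟩
  · exact biUnion_mono h.1 fun i _ => approximable_mono _ _ _ (hι h.2)
  · obtain ⟨F, hF⟩ := exists_finset_subset_iUnion hcov K
    choose f hf hf' using fun i => exists_subset_approximable (K.isCompact.inter_right (hC i))
      inter_subset_right (e' i) (he' i)
    obtain ⟨l, hl⟩ := hL F α f hα hf
    refine ⟨_, ⟨(F, l), rfl⟩, fun x hx => ?_⟩
    obtain ⟨i, hi, hxi⟩ := mem_iUnion₂.1 (hF hx)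
    exact mem_biUnion hi (approximable_mono _ _ _ (hl i hi) (hf' i ⟨hx, hxi⟩))

theorem exists_nhds_subset_closure_image_Iio {X : Type u} [TopologicalSpace X] (x : X) :
    ∃ U ∈ 𝓝 x, ∃ e : Ordinal.{u} → X, U ⊆ closure (e '' Iio (localDensityAt x).ord) := by
  classical
  obtain ⟨U, hU, hd⟩ := exists_nhds_topDensity_eq x
  obtain ⟨D, hD, hc⟩ := exists_dense_mk_eq_topDensity U
  rw [← hd, ← hc]
  obtain ⟨g⟩ := Cardinal.nonempty_Iio_ord_equiv (α := D) rfl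
  refine ⟨U, hU, fun β => if h : β ∈ Iio (Cardinal.mk D).ord then ((g ⟨β, h⟩ : U) : X) else x, ?_⟩
  have hsub : U ⊆ closure ((↑) '' D) := fun z hz =>
    (image_closure_subset_closure_image continuous_subtype_val) ⟨⟨z, hz⟩, hD _, rfl⟩
  refine hsub.trans (closure_mono ?_)
  rintro _ ⟨d, hd, rfl⟩
  refine ⟨g.symm ⟨d, hd⟩, (g.symm ⟨d, hd⟩).2, ?_⟩
  simp only [dif_pos (g.symm ⟨d, hd⟩).2, Subtype.coe_eta, Equiv.apply_symm_apply]

theorem finSubsets_prod_finSeq_cofinalLE_compacts {X : Type u} [MetricSpace X] [CompleteSpace X]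
    (hX : ¬ CompactSpace X) :
    CofinalLE (FinSubsets (topDensity X) × FinSeq (localDensity X)) (Compacts X) := by
  classical
  refine finSubsets_prod_cofinalLE_compacts hX id monotone_id
    (fun α => α ≤ (localDensity X).ord) (fun x => ?_) fun F α f _ _ => ⟨F.sup f, fun i hi =>
      Finset.le_sup (f := f) hi⟩
  obtain ⟨U, hU, e, he⟩ := exists_nhds_subset_closure_image_Iio x
  have hle := Cardinal.ord_le_ord.2 (localDensityAt_le x)
  refine ⟨U, hU, _, hle, e, ?_⟩
  rwa [inter_eq_left.2 (Iio_subset_Iio hle)]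

theorem finSubsets_prod_bddFinSeq_cofinalLE_compacts {X : Type u} [MetricSpace X]
    [CompleteSpace X] (hX : ¬ CompactSpace X) (hr : ¬ LocalDensityRealized X) :
    CofinalLE (FinSubsets (topDensity X) × BddFinSeq (localDensity X)) (Compacts X) := by
  classical
  have hlt : ∀ x : X, localDensityAt x < localDensity X := fun x =>
    (localDensityAt_le x).lt_of_ne fun h => hr ⟨x, h⟩
  have hpos : 0 < (localDensity X).ord := by
    by_contra! h
    rw [nonpos_iff_eq_zero, Cardinal.ord_eq_zero] at h
    have : IsEmpty X := ⟨fun x => not_lt_zero (h ▸ hlt x)⟩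
    exact hX inferInstance
  refine finSubsets_prod_cofinalLE_compacts hX Subtype.val (fun _ _ h => h)
    (fun α => α < (localDensity X).ord) (fun x => ?_) fun F α f hα hf => ?_
  · obtain ⟨U, hU, e, he⟩ := exists_nhds_subset_closure_image_Iio x
    have hle := Cardinal.ord_lt_ord.2 (hlt x)
    refine ⟨U, hU, _, hle, e, ?_⟩
    rwa [inter_eq_left.2 (Iio_subset_Iio hle.le)]
  · refine ⟨⟨F.sup f, F.sup α, (Finset.sup_lt_iff (by simpa using hpos)).2 fun i _ => hα i,
      fun n β hβ => ?_⟩, fun i hi => Finset.le_sup (f := f) hi⟩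
    rw [Finset.sup_apply, Finset.mem_sup] at hβ
    obtain ⟨i, hi, h⟩ := hβ
    exact (hf i n β h).trans_le (Finset.le_sup hi)

/-! ### Lower bounds at the local density. -/

/-- For each `α` below the local density some point yields `fin(α)^ℕ`. The finite set `φ K` selects
which `α` contribute, so the combined sequence is finite at each `n` and bounded by the largest
selected `α`. -/
theorem cofinalLE_compacts_bddFinSeq {X : Type u} [MetricSpace X]
    (hX : ¬ LocallyCompactSpace X) (hr : ¬ LocalDensityRealized X) :
    CofinalLE (Compacts X) (BddFinSeq (localDensity X)) := by
  classical
  have hcpt : ¬ CompactSpace X := fun h => hX inferInstance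
  have hlt : ∀ x : X, localDensityAt x < localDensity X := fun x =>
    (localDensityAt_le x).lt_of_ne fun h => hr ⟨x, h⟩
  obtain ⟨z, hz⟩ := exists_forall_mem_nhds_not_isCompact hX
  have hpos : 0 < (localDensity X).ord := by
    rw [Cardinal.lt_ord, Ordinal.card_zero]
    exact (zero_le).trans_lt (hlt z)
  have hex : ∀ α : Iio (localDensity X).ord,
      CofinalLE (Compacts X) (ℕ → Finset (Iio (α : Ordinal.{u}))) := by
    intro α
    -- The maximum with `ℵ₀` gives the chosen point uncountable local density, hence no compact
    -- neighborhood.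
    have hα : max (α : Ordinal.{u}).card Cardinal.aleph0 < localDensity X :=
      max_lt (Cardinal.lt_ord.1 α.2) ((aleph0_le_localDensityAt hz).trans_lt (hlt z))
    obtain ⟨x, hx⟩ := exists_lt_of_lt_ciSup' hα
    refine cofinalLE_compacts_seq_finset (x := x) (not_isCompact_of_aleph0_lt_localDensityAt
      ((le_max_right _ _).trans_lt hx)) _ ?_
    rw [Cardinal.mk_Iio_ordinal, Cardinal.lift_lift, Cardinal.lift_le]
    exact (le_max_left _ _).trans hx.le
  choose ψ hψ hψ' using hex
  obtain ⟨φ, hφ, hφ'⟩ := cofinalLE_compacts_finSubsets hcpt (localDensity_le_topDensity X)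
  let j : ∀ α : Iio (localDensity X).ord, Iio (α : Ordinal.{u}) → Iio (localDensity X).ord :=
    fun α β => ⟨β, mem_Iio.2 (lt_trans (mem_Iio.1 β.2) (mem_Iio.1 α.2))⟩
  let Ψ : Compacts X → FinSeq (localDensity X) := fun K n =>
    (φ K).biUnion fun α => (ψ α K n).image (j α)
  have hΨ : ∀ K, ∃ α : Ordinal.{u}, α < (localDensity X).ord ∧
      ∀ n, ∀ β ∈ Ψ K n, (β : Ordinal.{u}) < α := fun K => by
    refine ⟨(φ K).sup (fun α => (α : Ordinal.{u})),
      (Finset.sup_lt_iff (by simpa using hpos)).2 fun α _ => α.2, fun n β hβ => ?_⟩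
    obtain ⟨α, hα, hβ⟩ := Finset.mem_biUnion.1 hβ
    obtain ⟨γ, -, rfl⟩ := Finset.mem_image.1 hβ
    exact lt_of_lt_of_le γ.2
      (Finset.le_sup (f := fun α : Iio (localDensity X).ord => (α : Ordinal.{u})) hα)
  refine ⟨fun K => ⟨Ψ K, hΨ K⟩, fun K L h n => ?_, fun ⟨g, α, hα, hg⟩ => ?_⟩
  · exact (Finset.biUnion_subset_biUnion_of_subset_left _ (hφ h)).trans
      (Finset.biUnion_mono fun α _ => Finset.image_subset_image (hψ α h n))
  · obtain ⟨_, ⟨K, rfl⟩, hK⟩ := hφ' {⟨α, hα⟩}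
    have hL' := hψ' ⟨α, hα⟩ fun n =>
      (g n).attach.image fun β => (⟨(β.1 : Ordinal.{u}), mem_Iio.2 (hg n β.1 β.2)⟩ : Iio α)
    obtain ⟨_, ⟨L, rfl⟩, hL⟩ := hL'
    -- `K` ensures that `α` is selected, and `L` that its coordinate dominates `g`.
    refine ⟨_, ⟨K ⊔ L, rfl⟩, fun n β hβ => Finset.mem_biUnion.2 ⟨⟨α, hα⟩, ?_, ?_⟩⟩
    · exact hφ (le_sup_left (b := L)) (hK (Finset.mem_singleton_self _))
    · refine Finset.mem_image.2 ⟨⟨β, mem_Iio.2 (hg n β hβ)⟩, hψ _ (le_sup_right (a := K)) n (hL n ?_), rfl⟩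
      exact Finset.mem_image.2 ⟨⟨β, hβ⟩, Finset.mem_attach _ _, rfl⟩

theorem cofinalLE_compacts_finSeq {X : Type u} [MetricSpace X]
    (hX : ¬ LocallyCompactSpace X) (hr : LocalDensityRealized X) :
    CofinalLE (Compacts X) (FinSeq (localDensity X)) := by
  have hex : ∃ x : X, (∀ U ∈ 𝓝 x, ¬ IsCompact U) ∧ localDensity X ≤ localDensityAt x := by
    obtain ⟨x, hx⟩ := hr
    obtain ⟨z, hz⟩ := exists_forall_mem_nhds_not_isCompact hX
    -- A realizing point may have a compact neighborhood when the local density is countable; then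
    -- any point without one serves instead.
    rcases le_or_gt (localDensity X) Cardinal.aleph0 with h | h
    · exact ⟨z, hz, h.trans (aleph0_le_localDensityAt hz)⟩
    · exact ⟨x, not_isCompact_of_aleph0_lt_localDensityAt (hx ▸ h), hx.ge⟩
  obtain ⟨x, hx, hle⟩ := hex
  refine cofinalLE_compacts_seq_finset hx _ ?_
  rwa [Cardinal.mk_Iio_ord, Cardinal.lift_lift, Cardinal.lift_le]

/-! ### Uncountable cofinality and conclusion. -/

/-- If `c` has uncountable cofinality, then every sequence of finite subsets of `c` is bounded. -/
theorem FinSeq.exists_bound {c : Cardinal.{u}} (hc : Cardinal.aleph0 < c.ord.cof)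
    (f : FinSeq c) : ∃ α : Ordinal.{u}, α < c.ord ∧ ∀ n, ∀ β ∈ f n, (β : Ordinal.{u}) < α := by
  have hlim : Order.IsSuccLimit c.ord := Ordinal.one_lt_cof_iff.1 (Cardinal.one_lt_aleph0.trans hc)
  -- Successors make the eventual bound strict.
  have hlt : ∀ n, (f n).sup (fun β => Order.succ (β : Ordinal.{u})) < c.ord := fun n =>
    (Finset.sup_lt_iff hlim.bot_lt).2 fun β _ => hlim.succ_lt β.2
  refine ⟨⨆ n, (f n).sup fun β => Order.succ (β : Ordinal.{u}),
    Ordinal.lift_iSup_lt_of_lt_cof (by simpa using hc) hlt, fun n β hβ => ?_⟩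
  refine (Order.lt_succ (β : Ordinal.{u})).trans_le (le_trans (Finset.le_sup
    (f := fun β : Iio c.ord => Order.succ (β : Ordinal.{u})) hβ) ?_)
  exact Ordinal.le_iSup (fun n => (f n).sup fun β => Order.succ (β : Ordinal.{u})) n

theorem mainTheorem2 (X : Type u) [MetricSpace X] [CompleteSpace X] :
    (¬ CompactSpace X → LocallyCompactSpace X →
      CofinalEquiv (TopologicalSpace.Compacts X) (FinSubsets (topDensity X))) ∧
    (¬ LocallyCompactSpace X →
      (¬ LocalDensityRealized X →
        CofinalEquiv (TopologicalSpace.Compacts X)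
          (FinSubsets (topDensity X) × BddFinSeq (localDensity X))) ∧
      (LocalDensityRealized X ∨ Cardinal.aleph0 < (localDensity X).ord.cof →
        CofinalEquiv (TopologicalSpace.Compacts X)
          (FinSubsets (topDensity X) × FinSeq (localDensity X)))) := by
  refine ⟨fun hX _ => ⟨cofinalLE_compacts_finSubsets hX le_rfl,
    finSubsets_cofinalLE_compacts hX⟩, fun hlc => ?_⟩
  have hX : ¬ CompactSpace X := fun h => hlc inferInstance
  have hfin := cofinalLE_compacts_finSubsets hX (le_refl (topDensity X))
  refine ⟨fun hr => ⟨hfin.prod (cofinalLE_compacts_bddFinSeq hlc hr),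
    finSubsets_prod_bddFinSeq_cofinalLE_compacts hX hr⟩, fun h => ⟨hfin.prod ?_,
    finSubsets_prod_finSeq_cofinalLE_compacts hX⟩⟩
  by_cases hr : LocalDensityRealized X
  · exact cofinalLE_compacts_finSeq hlc hr
  · obtain ⟨ψ, hψ, hψ'⟩ := cofinalLE_compacts_bddFinSeq hlc hr
    refine ⟨fun K => (ψ K).1, fun _ _ hKL => hψ hKL, fun f => ?_⟩
    obtain ⟨_, ⟨K, rfl⟩, hK⟩ := hψ' ⟨f, FinSeq.exists_bound (h.resolve_left hr) f⟩
    exact ⟨_, ⟨K, rfl⟩, hK⟩
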